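/- Let $n\ge 1$ and $a>0$, let $z=(z^1,\dots,z^n)$ be the standard coordinates on $\mathbb{C}^n\setminus\{0\}$, and put $u=|z|^2=\sum_\mu |z^\mu|^2$, $z_\mu=z^\mu$ and $\bar z_\mu=\overline{z^\mu}$. Consider on $\mathbb{C}^n\setminus\{0\}$ the (Calabi–Eguchi–Hanson) metric with components $$g_{\mu\bar\nu}=\sqrt[n]{1+\frac{a^n}{u^n}}\left(\delta_{\mu\bar\nu}-\frac{a^n}{a^n+u^n}\,\frac{\bar z_\mu z_\nu}{u}\right),$$ extended complex-bilinearly to the complexified tangent spaces by $g_{\bar\nu\mu}=g_{\mu\bar\nu}$ and $g_{\mu\nu}=g_{\bar\mu\bar\nu}=0$. Let $\nabla$ be its Levi-Civita connection and $R(X,Y)=\nabla_X\nabla_Y-\nabla_Y\nabla_X-\nabla_{[X,Y]}$. Write $\partial_\mu=\partial/\partial z^\mu$ and $\partial_{\bar\mu}=\partial/\partial\bar z^\mu$; denote by $\Gamma^\lambda_{\mu\alpha}$ the component of $\nabla_{\partial_\mu}\partial_\alpha$ along $\partial_\lambda$, and put $R_{\mu\bar\nu\alpha\bar\beta}=g\big(R(\partial_\alpha,\partial_{\bar\beta})\partial_\mu,\partial_{\bar\nu}\big)$.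 Then, at every point of $\mathbb{C}^n\setminus\{0\}$ and for all indices, the following hold. 1. The Christoffel symbols are $$\Gamma^\lambda_{\mu\alpha}=-\frac{a^n}{u(a^n+u^n)}\left(\bar z_\mu\,\delta^\lambda{}_\alpha+\bar z_\alpha\,\delta^\lambda{}_\mu-(n+1)\frac{\bar z_\alpha\bar z_\mu}{u}z^\lambda\right).$$ 2. The curvature tensor is $$\begin{aligned}R_{\mu\bar\nu\alpha\bar\beta}=\frac{a^n}{(a^n+u^n)^{\frac{n+1}{n}}}\Bigg(&g_{\alpha\bar\nu}g_{\mu\bar\beta}+g_{\mu\bar\nu}g_{\alpha\bar\beta}\\&-(n+1)\left(\frac{u}{\sqrt[n]{a^n+u^n}}\right)^{n-1}\left(\frac{\bar z_\mu z_\beta}{u}g_{\alpha\bar\nu}+\frac{\bar z_\alpha z_\beta}{u}g_{\mu\bar\nu}+\frac{\bar z_\mu z_\nu}{u}g_{\alpha\bar\beta}+\frac{\bar z_\alpha z_\nu}{u}g_{\mu\bar\beta}\right)\\&+(n+1)(n+2)\left(\frac{u}{\sqrt[n]{a^n+u^n}}\right)^{2n-2}\frac{\bar z_\mu z_\nu\bar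 z_\alpha z_\beta}{u^2}\Bigg).\end{aligned}$$ 3. The Kretschmann scalar $K=\sum_{\mu,\nu,\alpha,\beta}R_{\mu\bar\nu\alpha\bar\beta}\,R^{\mu\bar\nu\alpha\bar\beta}$, where the indices of the curvature tensor are raised with the inverse of the metric (so that $K$ is the squared norm of $R_{\mu\bar\nu\alpha\bar\beta}$ with respect to $g$), is $$K=\frac{a^{2n}}{(a^n+u^n)^{2\left(\frac{n+1}{n}\right)}}\,n(n+2)(n^2-1).$$ In particular, for $n=2$, $K=\dfrac{24a^4}{(a^2+u^2)^3}$. -/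

import Mathlib

/-!
Tensor calculus on open subsets of `ℂⁿ` in the complex coordinate frame.

The complexified tangent space at a point has the basis
`∂_μ = ∂/∂z^μ`, `∂_{ν̄} = ∂/∂z̄^ν`. Its index set is `Fin n ⊕ Fin n`: `Sum.inl μ` is the holomorphic
index `μ` and `Sum.inr ν` is the antiholomorphic index `ν̄`.
-/

noncomputable section

namespace ComplexFrame

/-- Complex coordinate indices: `Sum.inl μ` stands for `μ`, `Sum.inr ν` for `ν̄`. -/
abbrev Idx (n : ℕ) : Type := Fin n ⊕ Fin n

/-- The Wirtinger derivatives
`∂f/∂z^μ = (∂f/∂x^μ - i ∂f/∂y^μ)/2` and `∂f/∂z̄^μ = (∂f/∂x^μ + i ∂f/∂y^μ)/2`,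
where `z^μ = x^μ + i y^μ`. -/
def wirtinger {n : ℕ} : Idx n → ((Fin n → ℂ) → ℂ) → (Fin n → ℂ) → ℂ
  | Sum.inl μ, f, z =>
      (1 / 2 : ℂ) * (fderiv ℝ f z (Pi.single μ 1)
        - Complex.I * fderiv ℝ f z (Pi.single μ Complex.I))
  | Sum.inr μ, f, z =>
      (1 / 2 : ℂ) * (fderiv ℝ f z (Pi.single μ 1)
        + Complex.I * fderiv ℝ f z (Pi.single μ Complex.I))

/-- The complex-bilinear extension of the Riemannian metric of a Hermitian metric with components
`g_{μν̄}`: its components are `G_{μν̄} = G_{ν̄μ} = g_{μν̄}` and `G_{μν} = G_{μ̄ν̄} = 0`. -/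
def bilinearExtension {n : ℕ} (g : (Fin n → ℂ) → Matrix (Fin n) (Fin n) ℂ) :
    (Fin n → ℂ) → Matrix (Idx n) (Idx n) ℂ :=
  fun z => Matrix.fromBlocks 0 (g z) (g z).transpose 0

/-- The Christoffel symbols `Γ^C_{AB}` of the Levi-Civita connection of `G`, with
`∇_{∂_A} ∂_B = Γ^C_{AB} ∂_C`:
`Γ^C_{AB} = ½ G^{CD} (∂_A G_{BD} + ∂_B G_{AD} - ∂_D G_{AB})`. -/
def christoffel {n : ℕ} (G : (Fin n → ℂ) → Matrix (Idx n) (Idx n) ℂ)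
    (C A B : Idx n) (z : Fin n → ℂ) : ℂ :=
  (1 / 2 : ℂ) * ∑ D, (G z)⁻¹ C D *
    (wirtinger A (fun w => G w B D) z + wirtinger B (fun w => G w A D) z - wirtinger D (fun w => G w A B) z)

/-- The component along `∂_D` of `R(∂_A, ∂_B) ∂_C`, where
`R(X, Y) = ∇_X ∇_Y - ∇_Y ∇_X - ∇_{[X, Y]}` for the Levi-Civita connection `∇` of `G`. -/
def curvatureOperator {n : ℕ} (G : (Fin n → ℂ) → Matrix (Idx n) (Idx n) ℂ)
    (D A B C : Idx n) (z : Fin n → ℂ) : ℂ :=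
  wirtinger A (christoffel G D B C) z - wirtinger B (christoffel G D A C) z
    + ∑ E, (christoffel G D A E z * christoffel G E B C z
      - christoffel G D B E z * christoffel G E A C z)

/-- The curvature tensor with all indices lowered,
`R_{ABCD} = G(R(∂_C, ∂_D) ∂_A, ∂_B)`. -/
def curvature {n : ℕ} (G : (Fin n → ℂ) → Matrix (Idx n) (Idx n) ℂ)
    (A B C D : Idx n) (z : Fin n → ℂ) : ℂ :=
  ∑ E, curvatureOperator G E C D A z * G z E B

/-- The curvature tensor with all indices raised by the inverse metric. -/
def curvatureRaised {n : ℕ} (G : (Fin n → ℂ) → Matrix (Idx n) (Idx n) ℂ)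
    (A B C D : Idx n) (z : Fin n → ℂ) : ℂ :=
  ∑ A', ∑ B', ∑ C', ∑ D',
    (G z)⁻¹ A A' * (G z)⁻¹ B B' * (G z)⁻¹ C C' * (G z)⁻¹ D D' * curvature G A' B' C' D' z

/-- The Kretschmann scalar in complex notation: the contraction of the components
`R_{μν̄αβ̄}` with the components of the raised curvature tensor in the same index slots
(these are obtained by raising `R_{σ̄ργ̄δ}`, the complex conjugate of `R_{σρ̄γδ̄}`). -/
def kretschmann {n : ℕ} (G : (Fin n → ℂ) → Matrix (Idx n) (Idx n) ℂ) (z : Fin n → ℂ) : ℂ :=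
  ∑ μ : Fin n, ∑ ν : Fin n, ∑ α : Fin n, ∑ β : Fin n,
    curvature G (Sum.inl μ) (Sum.inr ν) (Sum.inl α) (Sum.inr β) z *
      curvatureRaised G (Sum.inl μ) (Sum.inr ν) (Sum.inl α) (Sum.inr β) z

end ComplexFrame

namespace EguchiHanson

/-- `u = |z|²`, the squared Euclidean norm on `ℂⁿ`. -/
def sqNorm {n : ℕ} (z : Fin n → ℂ) : ℝ := ∑ μ, ‖z μ‖ ^ 2

/-- The Kronecker delta. -/
def delta {n : ℕ} (μ ν : Fin n) : ℂ := if μ = ν then 1 else 0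

/-- `z̄_μ`, the complex conjugate of the coordinate `z^μ`. -/
def zbar {n : ℕ} (z : Fin n → ℂ) (μ : Fin n) : ℂ := (starRingEnd ℂ) (z μ)

/-- The components `g_{μν̄}` of the Calabi–Eguchi–Hanson metric with parameter `a`:
`g_{μν̄} = (1 + aⁿ/uⁿ)^{1/n} (δ_{μν} - aⁿ/(aⁿ + uⁿ) · z̄_μ z_ν / u)`. -/
def metric {n : ℕ} (a : ℝ) (z : Fin n → ℂ) : Matrix (Fin n) (Fin n) ℂ :=
  Matrix.of fun μ ν =>
    (((1 + a ^ n / sqNorm z ^ n) ^ (1 / (n : ℝ)) : ℝ) : ℂ) *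
      (delta μ ν
        - ((a ^ n / (a ^ n + sqNorm z ^ n) : ℝ) : ℂ) * (zbar z μ * z ν / (sqNorm z : ℂ)))

/-- The Calabi–Eguchi–Hanson metric as a complex-bilinear form on the complexified tangent
spaces of `ℂⁿ ∖ {0}`. -/
def fullMetric (n : ℕ) (a : ℝ) :
    (Fin n → ℂ) → Matrix (ComplexFrame.Idx n) (ComplexFrame.Idx n) ℂ :=
  ComplexFrame.bilinearExtension (metric a)

end EguchiHanson

end

/-! The metric is `P (δ - Q z̄_μ z_ν)`, where `P = conformalFactor` and `Q = radialCoeff` depend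
only on `u` and satisfy `P' = -PQ` and `Q' = nQ² - (n+1)Q/u`. All derivatives are therefore rational
in `P`, `Q`, `u`, `δ` and the coordinates, and parts 1 and 2 reduce to algebra.

The first derivatives of `g` have the Kähler symmetry (`wirtinger_metric_inl_comm`,
`wirtinger_metric_inr_comm`), so `Γ^λ_{μα} = g^{λν̄} ∂_μ g_{αν̄}` and `R_{μν̄αβ̄} = -g_{λν̄} ∂_β̄
Γ^λ_{αμ}`. Since `z` is an eigenvector of `g` with eigenvalue `x = P(1 - Qu)` (`sum_mul_metric`),
both contractions with `g` are explicit.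

For the Kretschmann scalar, let `T = (x/u) z̄_μ z_ν`, so that `p = T g⁻¹` is a rank-one projection.
The curvature is `Q/P` times `symSq (g - (n+1)T) - n(n+1)/2 · symSq T`. Its squared norm involves
only traces of polynomials in `p`, with `p² = p` and `tr p = 1` (`sum_symSq_sub_mul_symSq_sub`). -/

namespace ComplexFrame

/-! ### Wirtinger calculus. -/

/-- `f` is real differentiable at `z`, with Wirtinger derivatives `d`. -/
def HasWirtingerAt {n : ℕ} (f : (Fin n → ℂ) → ℂ) (d : Idx n → ℂ) (z : Fin n → ℂ) : Prop :=
  DifferentiableAt ℝ f z ∧ ∀ A, wirtinger A f z = d A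

namespace HasWirtingerAt

variable {n : ℕ} {f g : (Fin n → ℂ) → ℂ} {d e : Idx n → ℂ} {z : Fin n → ℂ}

theorem wirtinger_eq (hf : HasWirtingerAt f d z) (A : Idx n) : wirtinger A f z = d A := hf.2 A

theorem const (c : ℂ) (z : Fin n → ℂ) : HasWirtingerAt (fun _ => c) (fun _ => 0) z := by
  refine ⟨differentiableAt_const c, ?_⟩
  rintro (μ | μ) <;> simp [wirtinger]

theorem congr_of_eventuallyEq (hf : HasWirtingerAt f d z) (h : g =ᶠ[nhds z] f) :
    HasWirtingerAt g d z := by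
  refine ⟨hf.1.congr_of_eventuallyEq h, fun A => ?_⟩
  rw [← hf.2 A]
  rcases A with μ | μ <;> simp only [wirtinger, h.fderiv_eq]

theorem congr_deriv (hf : HasWirtingerAt f d z) (h : ∀ A, d A = e A) : HasWirtingerAt f e z :=
  ⟨hf.1, fun A => (hf.2 A).trans (h A)⟩

theorem add (hf : HasWirtingerAt f d z) (hg : HasWirtingerAt g e z) :
    HasWirtingerAt (fun w => f w + g w) (fun A => d A + e A) z := by
  refine ⟨hf.1.add hg.1, fun A => ?_⟩
  beta_reduce
  rw [← hf.2 A, ← hg.2 A]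
  rcases A with μ | μ <;> simp only [wirtinger, fderiv_fun_add hf.1 hg.1,
    add_apply] <;> ring

theorem mul (hf : HasWirtingerAt f d z) (hg : HasWirtingerAt g e z) :
    HasWirtingerAt (fun w => f w * g w) (fun A => d A * g z + f z * e A) z := by
  refine ⟨hf.1.mul hg.1, fun A => ?_⟩
  beta_reduce
  rw [← hf.2 A, ← hg.2 A]
  rcases A with μ | μ <;> simp only [wirtinger, fderiv_fun_mul hf.1 hg.1,
    add_apply, smul_apply, smul_eq_mul] <;> ring

theorem const_mul (c : ℂ) (hf : HasWirtingerAt f d z) :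
    HasWirtingerAt (fun w => c * f w) (fun A => c * d A) z :=
  ((const c z).mul hf).congr_deriv fun A => by ring

theorem sub (hf : HasWirtingerAt f d z) (hg : HasWirtingerAt g e z) :
    HasWirtingerAt (fun w => f w - g w) (fun A => d A - e A) z := by
  have h := (hf.add (hg.const_mul (-1))).congr_deriv (e := fun A => d A - e A) fun A => by ring
  simpa [sub_eq_add_neg] using h

theorem sum {ι : Type*} (s : Finset ι) {F : ι → (Fin n → ℂ) → ℂ} {D : ι → Idx n → ℂ}
    (h : ∀ i ∈ s, HasWirtingerAt (F i) (D i) z) :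
    HasWirtingerAt (fun w => ∑ i ∈ s, F i w) (fun A => ∑ i ∈ s, D i A) z := by
  classical
  induction s using Finset.induction_on with
  | empty => simpa using const 0 z
  | insert i s hi ih =>
    simp only [Finset.sum_insert hi]
    exact (h i (by simp)).add (ih fun j hj => h j (by simp [hj]))

/-- Chain rule for a real function of a real-valued function. -/
theorem ofReal_comp {r : (Fin n → ℂ) → ℝ} (hr : HasWirtingerAt (fun w => (r w : ℂ)) d z)
    {φ : ℝ → ℝ} {φ' : ℝ} (hφ : HasDerivAt φ φ' (r z)) :
    HasWirtingerAt (fun w => (φ (r w) : ℂ)) (fun A => (φ' : ℂ) * d A) z := by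
  have hr' : DifferentiableAt ℝ r z :=
    Complex.reCLM.differentiableAt.comp z hr.1
  have h1 : HasFDerivAt (fun w => (r w : ℂ)) (Complex.ofRealCLM.comp (fderiv ℝ r z)) z :=
    Complex.ofRealCLM.hasFDerivAt.comp z hr'.hasFDerivAt
  have h2 : HasFDerivAt (fun w => (φ (r w) : ℂ))
      (Complex.ofRealCLM.comp (φ' • fderiv ℝ r z)) z :=
    Complex.ofRealCLM.hasFDerivAt.comp z (hφ.comp_hasFDerivAt z hr'.hasFDerivAt)
  refine ⟨h2.differentiableAt, fun A => ?_⟩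
  beta_reduce
  rw [← hr.2 A]
  rcases A with μ | μ <;> simp only [wirtinger, h1.fderiv, h2.fderiv,
    ContinuousLinearMap.comp_apply, smul_apply, Complex.ofRealCLM_apply,
    smul_eq_mul, Complex.ofReal_mul] <;> ring

end HasWirtingerAt

/-! ### Reality of the connection and the curvature. -/

/-- Complex conjugation of indices. -/
def conjIdx {n : ℕ} : Idx n ≃ Idx n := Equiv.sumComm _ _

theorem wirtinger_conj {n : ℕ} (A : Idx n) (f : (Fin n → ℂ) → ℂ) (z : Fin n → ℂ) :
    wirtinger (conjIdx A) (fun w => (starRingEnd ℂ) (f w)) z =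
      (starRingEnd ℂ) (wirtinger A f z) := by
  have h : fderiv ℝ (fun w => (starRingEnd ℂ) (f w)) z =
      (Complex.conjCLE : ℂ →L[ℝ] ℂ).comp (fderiv ℝ f z) := by
    simpa [Function.comp_def] using Complex.conjCLE.comp_fderiv (f := f) (x := z)
  rcases A with μ | μ <;> simp [conjIdx, wirtinger, h, map_ofNat]; ring

section Conjugation

variable {n : ℕ} {G : (Fin n → ℂ) → Matrix (Idx n) (Idx n) ℂ}

theorem inv_conj (hG : ∀ z A B, G z (conjIdx A) (conjIdx B) = (starRingEnd ℂ) (G z A B))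
    (z : Fin n → ℂ) (A B : Idx n) :
    (G z)⁻¹ (conjIdx A) (conjIdx B) = (starRingEnd ℂ) ((G z)⁻¹ A B) := by
  have h : (G z).submatrix conjIdx conjIdx = (starRingEnd ℂ).mapMatrix (G z) := by
    ext A B
    simp [hG]
  have h1 : ((G z)⁻¹).submatrix conjIdx conjIdx = (starRingEnd ℂ).mapMatrix (G z)⁻¹ := by
    rw [← Matrix.inv_submatrix_equiv, h, RingHom.mapMatrix_apply, RingHom.mapMatrix_apply]
    -- Invertibility is not assumed: a singular matrix has inverse `0`, which also commutes with
    -- conjugation.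
    by_cases hd : IsUnit (G z).det
    · apply Matrix.inv_eq_right_inv
      rw [← Matrix.map_mul, Matrix.mul_nonsing_inv _ hd]
      simp
    · have hd' : ¬ IsUnit ((G z).map (starRingEnd ℂ)).det := by
        rw [← RingHom.mapMatrix_apply, ← RingHom.map_det]
        simpa [isUnit_iff_ne_zero] using hd
      rw [Matrix.nonsing_inv_apply_not_isUnit _ hd, Matrix.nonsing_inv_apply_not_isUnit _ hd']
      simp
  simpa using congrFun (congrFun h1 A) B

theorem christoffel_conj (hG : ∀ z A B, G z (conjIdx A) (conjIdx B) = (starRingEnd ℂ) (G z A B))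
    (C A B : Idx n) (z : Fin n → ℂ) :
    christoffel G (conjIdx C) (conjIdx A) (conjIdx B) z =
      (starRingEnd ℂ) (christoffel G C A B z) := by
  unfold christoffel
  rw [← Equiv.sum_comp conjIdx]
  simp only [hG, inv_conj hG, wirtinger_conj]
  simp [map_ofNat]

theorem curvatureOperator_conj
    (hG : ∀ z A B, G z (conjIdx A) (conjIdx B) = (starRingEnd ℂ) (G z A B))
    (D A B C : Idx n) (z : Fin n → ℂ) :
    curvatureOperator G (conjIdx D) (conjIdx A) (conjIdx B) (conjIdx C) z =
      (starRingEnd ℂ) (curvatureOperator G D A B C z) := by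
  have h : ∀ C A B, christoffel G (conjIdx C) (conjIdx A) (conjIdx B) =
      fun w => (starRingEnd ℂ) (christoffel G C A B w) :=
    fun C A B => funext (christoffel_conj hG C A B)
  unfold curvatureOperator
  rw [← Equiv.sum_comp conjIdx]
  simp only [h, wirtinger_conj]
  simp

/-- If `G` is the complexification of a real metric, then so is its curvature tensor. -/
theorem curvature_conj (hG : ∀ z A B, G z (conjIdx A) (conjIdx B) = (starRingEnd ℂ) (G z A B))
    (A B C D : Idx n) (z : Fin n → ℂ) :
    curvature G (conjIdx A) (conjIdx B) (conjIdx C) (conjIdx D) z =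
      (starRingEnd ℂ) (curvature G A B C D z) := by
  unfold curvature
  rw [← Equiv.sum_comp conjIdx]
  simp only [curvatureOperator_conj hG, hG]
  simp

end Conjugation

/-! ### Kähler metrics: vanishing mixed symbols and the curvature formula. -/

section Hermitian

variable {n : ℕ} {g : (Fin n → ℂ) → Matrix (Fin n) (Fin n) ℂ} {z : Fin n → ℂ}

theorem bilinearExtension_conj (hg : ∀ z, (g z).IsHermitian) (z : Fin n → ℂ) (A B : Idx n) :
    bilinearExtension g z (conjIdx A) (conjIdx B) =
      (starRingEnd ℂ) (bilinearExtension g z A B) := by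
  have h : ∀ μ ν, (starRingEnd ℂ) (g z μ ν) = g z ν μ := fun μ ν => (hg z).apply ν μ
  rcases A with μ | μ <;> rcases B with ν | ν <;> simp [bilinearExtension, conjIdx, h]

theorem bilinearExtension_inv (hg : IsUnit (g z).det) :
    (bilinearExtension g z)⁻¹ = Matrix.fromBlocks 0 (g z)⁻¹.transpose (g z)⁻¹ 0 := by
  apply Matrix.inv_eq_right_inv
  simp only [bilinearExtension, Matrix.fromBlocks_multiply, zero_mul, mul_zero, zero_add, add_zero,
    Matrix.mul_nonsing_inv _ hg, ← Matrix.transpose_mul, Matrix.nonsing_inv_mul _ hg,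
    Matrix.transpose_one, Matrix.fromBlocks_one]

theorem wirtinger_const (A : Idx n) (c : ℂ) : wirtinger A (fun _ => c) z = 0 :=
  (HasWirtingerAt.const c z).wirtinger_eq A

/-- For a Kähler metric, the holomorphic Christoffel symbols satisfy
`Γ^λ_{μα} = g^{λν̄} ∂_μ g_{αν̄}`. -/
theorem christoffel_inl_inl_inl (hg : IsUnit (g z).det)
    (hK : ∀ μ α ν, wirtinger (Sum.inl μ) (fun w => g w α ν) z =
      wirtinger (Sum.inl α) (fun w => g w μ ν) z) (l μ α : Fin n) :
    christoffel (bilinearExtension g) (Sum.inl l) (Sum.inl μ) (Sum.inl α) z =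
      ∑ ν, (g z)⁻¹ ν l * wirtinger (Sum.inl μ) (fun w => g w α ν) z := by
  unfold christoffel
  rw [bilinearExtension_inv hg, Fintype.sum_sum_type]
  simp only [bilinearExtension, Matrix.fromBlocks_apply₁₁, Matrix.fromBlocks_apply₁₂,
    Matrix.zero_apply, zero_mul, Finset.sum_const_zero, zero_add, wirtinger_const, sub_zero,
    Matrix.transpose_apply, hK α μ]
  rw [Finset.mul_sum]
  exact Finset.sum_congr rfl fun ν _ => by ring

theorem christoffel_inr_inl_inl (hg : IsUnit (g z).det) (l μ α : Fin n) :
    christoffel (bilinearExtension g) (Sum.inr l) (Sum.inl μ) (Sum.inl α) z = 0 := by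
  unfold christoffel
  rw [bilinearExtension_inv hg, Fintype.sum_sum_type]
  simp [bilinearExtension, wirtinger_const]

/-- The inverse metric pairs `λ` only with barred indices, and the two surviving derivatives cancel
by the Kähler symmetry. -/
theorem christoffel_inl_inr_inl (hg : IsUnit (g z).det)
    (hK : ∀ β μ ν, wirtinger (Sum.inr β) (fun w => g w μ ν) z =
      wirtinger (Sum.inr ν) (fun w => g w μ β) z) (l β μ : Fin n) :
    christoffel (bilinearExtension g) (Sum.inl l) (Sum.inr β) (Sum.inl μ) z = 0 := by
  unfold christoffel
  rw [bilinearExtension_inv hg, Fintype.sum_sum_type]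
  simp [bilinearExtension, wirtinger_const, hK β μ]

theorem christoffel_inr_inr_inl (hg : IsUnit (g z).det)
    (hK : ∀ μ α ν, wirtinger (Sum.inl μ) (fun w => g w α ν) z =
      wirtinger (Sum.inl α) (fun w => g w μ ν) z) (l β μ : Fin n) :
    christoffel (bilinearExtension g) (Sum.inr l) (Sum.inr β) (Sum.inl μ) z = 0 := by
  unfold christoffel
  rw [bilinearExtension_inv hg, Fintype.sum_sum_type]
  simp [bilinearExtension, wirtinger_const, hK μ]

/-- For a Kähler metric, `R_{μν̄αβ̄} = - g_{λν̄} ∂_β̄ Γ^λ_{αμ}`. -/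
theorem curvature_inl_inr_inl_inr
    (hg : ∀ᶠ w in nhds z, IsUnit (g w).det)
    (hK : ∀ᶠ w in nhds z, ∀ μ α ν, wirtinger (Sum.inl μ) (fun w => g w α ν) w =
      wirtinger (Sum.inl α) (fun w => g w μ ν) w)
    (hK' : ∀ᶠ w in nhds z, ∀ β μ ν, wirtinger (Sum.inr β) (fun w => g w μ ν) w =
      wirtinger (Sum.inr ν) (fun w => g w μ β) w) (μ ν α β : Fin n) :
    curvature (bilinearExtension g) (Sum.inl μ) (Sum.inr ν) (Sum.inl α) (Sum.inr β) z =
      ∑ l, -wirtinger (Sum.inr β)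
        (christoffel (bilinearExtension g) (Sum.inl l) (Sum.inl α) (Sum.inl μ)) z * g z l ν := by
  -- The mixed symbol must vanish near `z`, not just at `z`, for its derivative to vanish; hence the
  -- eventual hypotheses.
  have h0 : ∀ l, wirtinger (Sum.inl α)
      (christoffel (bilinearExtension g) (Sum.inl l) (Sum.inr β) (Sum.inl μ)) z = 0 := fun l =>
    ((HasWirtingerAt.const 0 z).congr_of_eventuallyEq (by
      filter_upwards [hg, hK'] with w hw hw'
      exact christoffel_inl_inr_inl hw hw' l β μ)).wirtinger_eq _
  unfold curvature curvatureOperator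
  simp only [Fintype.sum_sum_type, h0, christoffel_inl_inr_inl hg.self_of_nhds hK'.self_of_nhds,
    christoffel_inr_inr_inl hg.self_of_nhds hK.self_of_nhds,
    christoffel_inr_inl_inl hg.self_of_nhds]
  simp [bilinearExtension]

/-- Raising exchanges barred and unbarred slots, so the components `R_{σ̄ργ̄δ}` enter; by reality
they are conjugates of those already computed. -/
theorem curvatureRaised_inl_inr_inl_inr (hg : IsUnit (g z).det) (hH : ∀ z, (g z).IsHermitian)
    (μ ν α β : Fin n) :
    curvatureRaised (bilinearExtension g) (Sum.inl μ) (Sum.inr ν) (Sum.inl α) (Sum.inr β) z =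
      ∑ σ, ∑ ρ, ∑ γ, ∑ δ, (g z)⁻¹ σ μ * (g z)⁻¹ ν ρ * (g z)⁻¹ γ α * (g z)⁻¹ β δ *
        (starRingEnd ℂ) (curvature (bilinearExtension g)
          (Sum.inl σ) (Sum.inr ρ) (Sum.inl γ) (Sum.inr δ) z) := by
  unfold curvatureRaised
  rw [bilinearExtension_inv hg]
  simp only [Fintype.sum_sum_type, Matrix.fromBlocks_apply₁₁, Matrix.fromBlocks_apply₁₂,
    Matrix.fromBlocks_apply₂₁, Matrix.fromBlocks_apply₂₂, Matrix.zero_apply, zero_mul, mul_zero,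
    Finset.sum_const_zero, zero_add, add_zero, Matrix.transpose_apply]
  simp only [← curvature_conj (bilinearExtension_conj hH)]
  simp [conjIdx]

end Hermitian

end ComplexFrame

/-! ### Algebra of symmetrised squares and their norms. -/

section SymSq

variable {ι R : Type*} [Fintype ι] [CommRing R]

/-- The tensor `X_{μν} X_{αβ} + X_{αν} X_{μβ}`. -/
def symSq (X : Matrix ι ι R) (μ ν α β : ι) : R := X μ ν * X α β + X α ν * X μ β

theorem sum_mul_symSq (H X : Matrix ι ι R) (μ ν α β : ι) :
    ∑ σ, ∑ ρ, ∑ γ, ∑ δ, H σ μ * H ν ρ * H γ α * H β δ * symSq X σ ρ γ δ =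
      symSq (H.transpose * X * H.transpose) μ ν α β := by
  have h : ∀ μ ν, (H.transpose * X * H.transpose) μ ν = ∑ ρ, ∑ σ, H σ μ * X σ ρ * H ν ρ := by
    intro μ ν
    simp only [Matrix.mul_apply, Matrix.transpose_apply, Finset.sum_mul]
  have h1 : ∀ μ ν α β, ∑ σ, ∑ ρ, ∑ γ, ∑ δ,
      H σ μ * H ν ρ * H γ α * H β δ * (X σ ρ * X γ δ) =
      (∑ ρ, ∑ σ, H σ μ * X σ ρ * H ν ρ) * ∑ ρ, ∑ σ, H σ α * X σ ρ * H β ρ := by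
    intro μ ν α β
    rw [Finset.sum_comm (f := fun ρ σ => H σ μ * X σ ρ * H ν ρ),
      Finset.sum_comm (f := fun ρ σ => H σ α * X σ ρ * H β ρ)]
    simp only [Finset.sum_mul]
    simp only [Finset.mul_sum]
    refine Finset.sum_congr rfl fun σ _ => ?_
    refine Finset.sum_congr rfl fun ρ _ => ?_
    refine Finset.sum_congr rfl fun γ _ => ?_
    exact Finset.sum_congr rfl fun δ _ => by ring
  -- Renaming `σ ↔ γ` moves the swap from the tensor to the free indices `μ`, `α`.
  have h2 : ∑ σ, ∑ ρ, ∑ γ, ∑ δ, H σ μ * H ν ρ * H γ α * H β δ * (X γ ρ * X σ δ) =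
      ∑ σ, ∑ ρ, ∑ γ, ∑ δ, H σ α * H ν ρ * H γ μ * H β δ * (X σ ρ * X γ δ) := by
    rw [Finset.sum_comm]
    conv_rhs => rw [Finset.sum_comm]
    refine Finset.sum_congr rfl fun ρ _ => ?_
    rw [Finset.sum_comm]
    refine Finset.sum_congr rfl fun σ _ => ?_
    refine Finset.sum_congr rfl fun γ _ => ?_
    exact Finset.sum_congr rfl fun δ _ => by ring
  simp only [symSq, mul_add, Finset.sum_add_distrib, h1, h2, h]

theorem sum_symSq_mul_symSq (X Y : Matrix ι ι R) :
    ∑ μ, ∑ ν, ∑ α, ∑ β, symSq X μ ν α β * symSq Y μ ν α β =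
      2 * ((X * Y.transpose).trace ^ 2
        + (X * Y.transpose * (X * Y.transpose)).trace) := by
  have ht : (X * Y.transpose).trace = ∑ μ, ∑ ν, X μ ν * Y μ ν := by
    simp [Matrix.trace, Matrix.mul_apply]
  have ht2 : (X * Y.transpose * (X * Y.transpose)).trace =
      ∑ μ, ∑ ν, ∑ α, ∑ β, X μ ν * Y α ν * (X α β * Y μ β) := by
    simp only [Matrix.trace, Matrix.diag_apply, Matrix.mul_apply, Matrix.transpose_apply,
      Finset.sum_mul_sum]
    exact Finset.sum_congr rfl fun μ _ => Finset.sum_comm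
  have h1 : ∑ μ, ∑ ν, ∑ α, ∑ β, X μ ν * X α β * (Y μ ν * Y α β) =
      (X * Y.transpose).trace ^ 2 := by
    rw [ht, sq]
    simp only [Finset.sum_mul, Finset.mul_sum]
    refine Finset.sum_congr rfl fun σ _ => ?_
    refine Finset.sum_congr rfl fun ρ _ => ?_
    refine Finset.sum_congr rfl fun γ _ => ?_
    exact Finset.sum_congr rfl fun δ _ => by ring
  have h2 : ∑ μ, ∑ ν, ∑ α, ∑ β, X μ ν * X α β * (Y α ν * Y μ β) =
      (X * Y.transpose * (X * Y.transpose)).trace := by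
    rw [ht2]
    refine Finset.sum_congr rfl fun σ _ => ?_
    refine Finset.sum_congr rfl fun ρ _ => ?_
    refine Finset.sum_congr rfl fun γ _ => ?_
    exact Finset.sum_congr rfl fun δ _ => by ring
  -- Exchanging `μ` and `α` makes the four products equal in pairs, whence the factor `2`.
  have hswap : ∀ F : ι → ι → ι → ι → R, ∑ μ, ∑ ν, ∑ α, ∑ β, F μ ν α β =
      ∑ μ, ∑ ν, ∑ α, ∑ β, F α ν μ β := by
    intro F
    rw [Finset.sum_comm]
    conv_rhs => rw [Finset.sum_comm]
    exact Finset.sum_congr rfl fun ν _ => Finset.sum_comm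
  have h3 := hswap fun μ ν α β => X α ν * X μ β * (Y μ ν * Y α β)
  have h4 := hswap fun μ ν α β => X α ν * X μ β * (Y α ν * Y μ β)
  simp only [h1, h2] at h3 h4
  simp only [symSq, add_mul, mul_add, Finset.sum_add_distrib, h1, h2, h3, h4]
  ring

/-- The squared norm, with respect to a metric with inverse `H`, of the tensor
`symSq (A - (n+1) T) - n(n+1)/2 symSq T`, when `A H = 1` and `T H` is a projection of rank one. -/
theorem sum_symSq_sub_mul_symSq_sub [DecidableEq ι] {A T H : Matrix ι ι ℂ} {N k : ℂ}
    (hN : N = Fintype.card ι) (hk : k = -(N * (N + 1) / 2)) (hA : A * H = 1)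
    (hT : T * H * (T * H) = T * H) (htr : (T * H).trace = 1)
    {B : Matrix ι ι ℂ} (hB : B = A - (N + 1) • T) :
    ∑ μ, ∑ ν, ∑ α, ∑ β, (symSq B μ ν α β + k * symSq T μ ν α β) *
      (symSq (H * B * H).transpose μ ν α β + k * symSq (H * T * H).transpose μ ν α β) =
      N * (N + 2) * (N ^ 2 - 1) := by
  have hBH : B * H = 1 - (N + 1) • (T * H) := by
    rw [hB, Matrix.sub_mul, hA, Matrix.smul_mul]
  have e : ∀ μ ν α β, (symSq B μ ν α β + k * symSq T μ ν α β) *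
      (symSq (H * B * H).transpose μ ν α β + k * symSq (H * T * H).transpose μ ν α β) =
      symSq B μ ν α β * symSq (H * B * H).transpose μ ν α β
      + k * (symSq B μ ν α β * symSq (H * T * H).transpose μ ν α β)
      + k * (symSq T μ ν α β * symSq (H * B * H).transpose μ ν α β)
      + k ^ 2 * (symSq T μ ν α β * symSq (H * T * H).transpose μ ν α β) := by
    intros; ring
  simp only [e, Finset.sum_add_distrib, ← Finset.mul_sum, sum_symSq_mul_symSq,
    Matrix.transpose_transpose]
  have a : ∀ X Y : Matrix ι ι ℂ, X * (H * Y * H) = (X * H) * (Y * H) := by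
    intros; simp only [Matrix.mul_assoc]
  simp only [a, hBH]
  -- From here on only `p² = p`, `tr p = 1` and `tr 1 = N` matter.
  generalize T * H = p at *
  have b1 : (1 - (N + 1) • p) * (1 - (N + 1) • p) = 1 + (N ^ 2 - 1) • p := by
    simp only [sub_mul, mul_sub, one_mul, mul_one, Matrix.smul_mul, Matrix.mul_smul, hT]
    module
  have b2 : (1 - (N + 1) • p) * p = (-N) • p := by
    simp only [sub_mul, one_mul, Matrix.smul_mul, hT]
    module
  have b3 : p * (1 - (N + 1) • p) = (-N) • p := by
    simp only [mul_sub, mul_one, Matrix.mul_smul, hT]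
    module
  have b4 : (1 + (N ^ 2 - 1) • p) * (1 + (N ^ 2 - 1) • p) = 1 + (N ^ 4 - 1) • p := by
    simp only [add_mul, mul_add, one_mul, mul_one, Matrix.smul_mul, Matrix.mul_smul, hT]
    module
  simp only [b1, b2, b3, b4, hT, Matrix.smul_mul, Matrix.mul_smul, Matrix.trace_add,
    Matrix.trace_smul, htr, Matrix.trace_one, ← hN, smul_eq_mul, hk]
  ring

end SymSq

/-! ### The radial functions `P` and `Q`. -/

noncomputable section

namespace EguchiHanson

open ComplexFrame

variable {n : ℕ} {a u : ℝ} {z : Fin n → ℂ}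

/-- The conformal factor `(1 + aⁿ/uⁿ)^{1/n}` of the metric. -/
def conformalFactor (n : ℕ) (a u : ℝ) : ℝ := (1 + a ^ n / u ^ n) ^ (1 / (n : ℝ))

/-- The coefficient `aⁿ / (u (aⁿ + uⁿ))`. -/
def radialCoeff (n : ℕ) (a u : ℝ) : ℝ := a ^ n / (u * (a ^ n + u ^ n))

theorem sqNorm_pos (hz : z ≠ 0) : 0 < sqNorm z := by
  obtain ⟨i, hi⟩ := Function.ne_iff.mp hz
  exact Finset.sum_pos' (fun j _ => by positivity)
    ⟨i, Finset.mem_univ i, by have := norm_pos_iff.mpr hi; positivity⟩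

theorem pos_of_ne_zero (hz : z ≠ 0) : 0 < n := by
  obtain ⟨i, -⟩ := Function.ne_iff.mp hz
  exact i.pos

theorem sum_zbar_mul (z : Fin n → ℂ) : ∑ μ, zbar z μ * z μ = (sqNorm z : ℂ) := by
  simp [sqNorm, zbar, Complex.conj_mul']

theorem conformalFactor_pos (ha : 0 < a) (hu : 0 < u) : 0 < conformalFactor n a u := by
  unfold conformalFactor
  positivity

theorem one_sub_radialCoeff_mul (ha : 0 < a) (hu : 0 < u) :
    1 - radialCoeff n a u * u = u ^ n / (a ^ n + u ^ n) := by
  have : a ^ n + u ^ n ≠ 0 := by positivity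
  unfold radialCoeff
  field_simp
  ring

theorem one_sub_radialCoeff_mul_ne_zero (ha : 0 < a) (hu : 0 < u) :
    1 - radialCoeff n a u * u ≠ 0 := by
  rw [one_sub_radialCoeff_mul ha hu]
  positivity

/-- The logarithmic derivative of `P` is `1/n` times that of `1 + aⁿ/uⁿ`, which is exactly `-Q`. -/
theorem hasDerivAt_conformalFactor (hn : 0 < n) (ha : 0 < a) (hu : 0 < u) :
    HasDerivAt (conformalFactor n a) (-(conformalFactor n a u * radialCoeff n a u)) u := by
  have hpow : HasDerivAt (fun x : ℝ => x ^ n) (n * u ^ (n - 1)) u := hasDerivAt_pow n u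
  have hb : HasDerivAt (fun x : ℝ => 1 + a ^ n / x ^ n)
      (-(a ^ n * (n * u ^ (n - 1))) / (u ^ n) ^ 2) u := by
    have := ((hasDerivAt_const u (a ^ n)).div hpow (by positivity)).const_add 1
    simpa using this
  have hb0 : 0 < 1 + a ^ n / u ^ n := by positivity
  have h := hb.rpow_const (p := 1 / (n : ℝ)) (Or.inl hb0.ne')
  refine h.congr_deriv ?_
  rw [Real.rpow_sub hb0, Real.rpow_one]
  unfold conformalFactor radialCoeff
  generalize (1 + a ^ n / u ^ n) ^ (1 / (n : ℝ)) = y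
  obtain ⟨m, rfl⟩ : ∃ m, n = m + 1 := ⟨n - 1, by omega⟩
  have h1 : a ^ (m + 1) + u ^ (m + 1) ≠ 0 := by positivity
  have h2 : 1 + a ^ (m + 1) / u ^ (m + 1) = (a ^ (m + 1) + u ^ (m + 1)) / u ^ (m + 1) := by
    field_simp
    ring
  have h3 : ((m + 1 : ℕ) : ℝ) ≠ 0 := by positivity
  rw [h2, Nat.add_sub_cancel]
  field_simp
  ring

theorem hasDerivAt_radialCoeff (hn : 0 < n) (ha : 0 < a) (hu : 0 < u) :
    HasDerivAt (radialCoeff n a)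
      (n * radialCoeff n a u ^ 2 - (n + 1) * radialCoeff n a u / u) u := by
  have hpow : HasDerivAt (fun x : ℝ => x ^ n) (n * u ^ (n - 1)) u := hasDerivAt_pow n u
  have h1 : a ^ n + u ^ n ≠ 0 := by positivity
  have h := (hasDerivAt_const u (a ^ n)).div ((hasDerivAt_id u).mul (hpow.const_add (a ^ n)))
    (mul_ne_zero hu.ne' h1)
  refine h.congr_deriv ?_
  unfold radialCoeff
  obtain ⟨m, rfl⟩ : ∃ m, n = m + 1 := ⟨n - 1, by omega⟩
  simp only [Nat.add_sub_cancel, Pi.mul_apply, id]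
  field_simp
  push_cast
  ring

theorem conformalFactor_eq (ha : 0 < a) (hu : 0 < u) (hn : 0 < n) :
    conformalFactor n a u = (a ^ n + u ^ n) ^ (1 / (n : ℝ)) / u := by
  have h2 : 1 + a ^ n / u ^ n = (a ^ n + u ^ n) / u ^ n := by
    field_simp
    ring
  rw [conformalFactor, h2, Real.div_rpow (by positivity) (by positivity), one_div,
    Real.pow_rpow_inv_natCast hu.le hn.ne']

/-- With `S` the `n`-th root of `aⁿ + uⁿ`, the factors are `S/u` and `(u/S)ⁿ`. This turns the
eigenvalue `x` into the form used in the curvature formula. -/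
theorem conformalFactor_mul_eq (hn : 0 < n) (ha : 0 < a) (hu : 0 < u) :
    conformalFactor n a u * (1 - radialCoeff n a u * u) =
      (u / (a ^ n + u ^ n) ^ (1 / (n : ℝ))) ^ (n - 1) := by
  rw [conformalFactor_eq ha hu hn, one_sub_radialCoeff_mul ha hu]
  have hS : ((a ^ n + u ^ n) ^ (1 / (n : ℝ))) ^ n = a ^ n + u ^ n := by
    rw [one_div, Real.rpow_inv_natCast_pow (by positivity) hn.ne']
  have hS0 : 0 < (a ^ n + u ^ n) ^ (1 / (n : ℝ)) := by positivity
  generalize (a ^ n + u ^ n) ^ (1 / (n : ℝ)) = S at *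
  obtain ⟨m, rfl⟩ : ∃ m, n = m + 1 := ⟨n - 1, by omega⟩
  rw [← hS, Nat.add_sub_cancel, div_pow]
  field_simp
  ring

theorem radialCoeff_div_conformalFactor (hn : 0 < n) (ha : 0 < a) (hu : 0 < u) :
    radialCoeff n a u / conformalFactor n a u =
      a ^ n / (a ^ n + u ^ n) ^ (((n : ℝ) + 1) / (n : ℝ)) := by
  have hn' : (n : ℝ) ≠ 0 := by positivity
  have h0 : 0 < a ^ n + u ^ n := by positivity
  have hS0 : 0 < (a ^ n + u ^ n) ^ (1 / (n : ℝ)) := by positivity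
  rw [conformalFactor_eq ha hu hn, add_div, div_self hn', Real.rpow_add h0, Real.rpow_one,
    radialCoeff]
  field_simp

/-! ### The metric as a rank-one perturbation of a multiple of the identity. -/

theorem metric_apply (a : ℝ) (z : Fin n → ℂ) (μ ν : Fin n) :
    metric a z μ ν = (conformalFactor n a (sqNorm z) : ℂ) *
      (delta μ ν - (radialCoeff n a (sqNorm z) : ℂ) * (zbar z μ * z ν)) := by
  simp only [metric, Matrix.of_apply, conformalFactor, radialCoeff,
    Complex.ofReal_mul, Complex.ofReal_inv, div_eq_mul_inv, mul_inv]
  ring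

theorem metric_isHermitian (a : ℝ) (z : Fin n → ℂ) : (metric a z).IsHermitian := by
  ext μ ν
  simp only [Matrix.conjTranspose_apply, metric_apply, delta, zbar, RCLike.star_def, map_mul,
    map_sub, Complex.conj_ofReal, Complex.conj_conj, eq_comm (a := ν), apply_ite (starRingEnd ℂ),
    map_one, map_zero]
  ring

theorem sum_delta_mul (μ : Fin n) (f : Fin n → ℂ) : ∑ l, delta l μ * f l = f μ := by
  simp [delta]

theorem delta_comm (μ ν : Fin n) : delta μ ν = delta ν μ := by
  simp [delta, eq_comm]

/-- The components of the inverse metric. -/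
def inverseMetric (a : ℝ) (z : Fin n → ℂ) : Matrix (Fin n) (Fin n) ℂ :=
  Matrix.of fun μ ν => (conformalFactor n a (sqNorm z) : ℂ)⁻¹ *
    (delta μ ν + (radialCoeff n a (sqNorm z) : ℂ) /
      (1 - (radialCoeff n a (sqNorm z) : ℂ) * (sqNorm z : ℂ)) * (zbar z μ * z ν))

/-- The rank-one term contracts through `∑ z̄_l z_l = u`, so `z` is a left eigenvector. -/
theorem sum_mul_metric (a : ℝ) (z : Fin n → ℂ) (ν : Fin n) :
    ∑ l, z l * metric a z l ν = (conformalFactor n a (sqNorm z) : ℂ) *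
      (1 - (radialCoeff n a (sqNorm z) : ℂ) * (sqNorm z : ℂ)) * z ν := by
  have h : ∀ l, z l * metric a z l ν = delta l ν * ((conformalFactor n a (sqNorm z) : ℂ) * z l)
      - zbar z l * z l * ((conformalFactor n a (sqNorm z) : ℂ) *
        (radialCoeff n a (sqNorm z) : ℂ) * z ν) := by
    intro l
    rw [metric_apply]
    ring
  simp only [h, Finset.sum_sub_distrib, sum_delta_mul, ← Finset.sum_mul, sum_zbar_mul]
  ring

theorem ofReal_one_sub_ne_zero (ha : 0 < a) (hu : 0 < u) :
    (1 - (radialCoeff n a u : ℂ) * (u : ℂ)) ≠ 0 := by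
  exact_mod_cast one_sub_radialCoeff_mul_ne_zero ha hu

/-- The Sherman–Morrison formula; it serves to show that the metric is nondegenerate. -/
theorem inverseMetric_mul_metric (ha : 0 < a) (hz : z ≠ 0) :
    inverseMetric a z * metric a z = 1 := by
  have hP : (conformalFactor n a (sqNorm z) : ℂ) ≠ 0 := by
    exact_mod_cast (conformalFactor_pos ha (sqNorm_pos hz)).ne'
  have hk := ofReal_one_sub_ne_zero (n := n) ha (sqNorm_pos hz)
  ext μ ν
  have h : ∀ l, inverseMetric a z μ l * metric a z l ν =
      delta l μ * ((conformalFactor n a (sqNorm z) : ℂ)⁻¹ * metric a z l ν)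
      + (conformalFactor n a (sqNorm z) : ℂ)⁻¹ * (radialCoeff n a (sqNorm z) : ℂ) /
      (1 - (radialCoeff n a (sqNorm z) : ℂ) * (sqNorm z : ℂ)) * zbar z μ *
        (z l * metric a z l ν) := by
    intro l
    rw [inverseMetric, Matrix.of_apply, delta_comm]
    ring
  rw [Matrix.mul_apply]
  simp only [h, Finset.sum_add_distrib, sum_delta_mul, ← Finset.mul_sum, sum_mul_metric]
  rw [metric_apply, Matrix.one_apply, ← delta]
  field_simp
  ring

theorem isUnit_det_metric (ha : 0 < a) (hz : z ≠ 0) : IsUnit (metric a z).det :=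
  Matrix.isUnit_det_of_left_inverse (inverseMetric_mul_metric ha hz)

/-! ### Derivatives, Christoffel symbols and curvature of the metric. -/

/-- The Wirtinger derivatives of the coordinate `z^μ`. -/
def dz (μ : Fin n) : Idx n → ℂ := Sum.elim (fun α => delta α μ) fun _ => 0

/-- The Wirtinger derivatives of the coordinate `z̄^μ`. -/
def dzbar (μ : Fin n) : Idx n → ℂ := Sum.elim (fun _ => 0) fun α => delta α μ

/-- The Wirtinger derivatives of `|z|²`. -/
def dsqNorm (z : Fin n → ℂ) : Idx n → ℂ := Sum.elim (zbar z) z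

theorem hasWirtingerAt_coord (μ : Fin n) (z : Fin n → ℂ) :
    HasWirtingerAt (fun w => w μ) (dz μ) z := by
  have h : HasFDerivAt (fun w : Fin n → ℂ => w μ)
      (ContinuousLinearMap.proj (R := ℝ) (φ := fun _ : Fin n => ℂ) μ) z :=
    (ContinuousLinearMap.proj (R := ℝ) (φ := fun _ : Fin n => ℂ) μ).hasFDerivAt
  refine ⟨h.differentiableAt, ?_⟩
  rintro (α | α) <;> simp only [wirtinger, h.fderiv, dz, delta, Sum.elim_inl, Sum.elim_inr] <;>
    by_cases hα : μ = α <;> simp [hα, eq_comm (a := α)] <;> norm_num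

theorem hasWirtingerAt_zbar (μ : Fin n) (z : Fin n → ℂ) :
    HasWirtingerAt (fun w => zbar w μ) (dzbar μ) z := by
  have h := hasWirtingerAt_coord μ z
  refine ⟨Complex.conjCLE.differentiableAt.comp z h.1, fun A => ?_⟩
  have h1 := wirtinger_conj (conjIdx A) (fun w => w μ) z
  rw [h.2] at h1
  rcases A with α | α <;> simpa [conjIdx, zbar, dz, dzbar, delta, apply_ite (starRingEnd ℂ)] using h1

theorem hasWirtingerAt_sqNorm (z : Fin n → ℂ) :
    HasWirtingerAt (fun w => (sqNorm w : ℂ)) (dsqNorm z) z := by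
  simp only [← sum_zbar_mul]
  refine (HasWirtingerAt.sum Finset.univ fun μ _ =>
    (hasWirtingerAt_zbar μ z).mul (hasWirtingerAt_coord μ z)).congr_deriv ?_
  rintro (α | α) <;> simp [dz, dzbar, dsqNorm, delta]

theorem hasWirtingerAt_conformalFactor (ha : 0 < a) (hz : z ≠ 0) :
    HasWirtingerAt (fun w => (conformalFactor n a (sqNorm w) : ℂ))
      (fun A => -((conformalFactor n a (sqNorm z) : ℂ) * (radialCoeff n a (sqNorm z) : ℂ))
        * dsqNorm z A) z :=
  ((hasWirtingerAt_sqNorm z).ofReal_comp (hasDerivAt_conformalFactor (pos_of_ne_zero hz) ha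
    (sqNorm_pos hz))).congr_deriv fun A => by push_cast; ring

theorem hasWirtingerAt_radialCoeff (ha : 0 < a) (hz : z ≠ 0) :
    HasWirtingerAt (fun w => (radialCoeff n a (sqNorm w) : ℂ))
      (fun A => (n * (radialCoeff n a (sqNorm z) : ℂ) ^ 2
        - (n + 1) * (radialCoeff n a (sqNorm z) : ℂ) / (sqNorm z : ℂ)) * dsqNorm z A) z :=
  ((hasWirtingerAt_sqNorm z).ofReal_comp (hasDerivAt_radialCoeff (pos_of_ne_zero hz) ha
    (sqNorm_pos hz))).congr_deriv fun A => by push_cast; ring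

/-- Product rule: the last coefficient is `-(PQ)'`, from the two radial differential equations. -/
theorem wirtinger_metric (ha : 0 < a) (hz : z ≠ 0) (A : Idx n) (μ ν : Fin n) {P Q u : ℂ}
    (hP : P = (conformalFactor n a (sqNorm z) : ℂ)) (hQ : Q = (radialCoeff n a (sqNorm z) : ℂ))
    (hu : u = (sqNorm z : ℂ)) :
    wirtinger A (fun w => metric a w μ ν) z =
      -(P * Q) * (dsqNorm z A * delta μ ν + dzbar μ A * z ν + zbar z μ * dz ν A)
      + P * Q * ((n + 1) / u - (n - 1) * Q) * dsqNorm z A * zbar z μ * z ν := by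
  simp only [metric_apply]
  rw [((hasWirtingerAt_conformalFactor ha hz).mul ((HasWirtingerAt.const (delta μ ν) z).sub
    ((hasWirtingerAt_radialCoeff ha hz).mul
      ((hasWirtingerAt_zbar μ z).mul (hasWirtingerAt_coord ν z))))).wirtinger_eq A, ← hP, ← hQ, ← hu]
  ring

/-- In holomorphic directions `z̄` is constant and `|z|²` has derivative `z̄_μ`, leaving an
expression symmetric in `μ` and `α`. -/
theorem wirtinger_metric_inl_comm (ha : 0 < a) (hz : z ≠ 0) (μ α ν : Fin n) :
    wirtinger (Sum.inl μ) (fun w => metric a w α ν) z =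
      wirtinger (Sum.inl α) (fun w => metric a w μ ν) z := by
  simp only [wirtinger_metric ha hz _ _ _ rfl rfl rfl, dsqNorm, dz, dzbar, Sum.elim_inl]
  ring

theorem wirtinger_metric_inr_comm (ha : 0 < a) (hz : z ≠ 0) (β μ ν : Fin n) :
    wirtinger (Sum.inr β) (fun w => metric a w μ ν) z =
      wirtinger (Sum.inr ν) (fun w => metric a w μ β) z := by
  simp only [wirtinger_metric ha hz _ _ _ rfl rfl rfl, dsqNorm, dz, dzbar, Sum.elim_inr,
    delta_comm μ]
  ring

theorem christoffel_fullMetric (ha : 0 < a) (hz : z ≠ 0) (l μ α : Fin n) :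
    christoffel (fullMetric n a) (Sum.inl l) (Sum.inl μ) (Sum.inl α) z =
      -(radialCoeff n a (sqNorm z) : ℂ) * (zbar z μ * delta l α + zbar z α * delta l μ
        - (n + 1) * (zbar z α * zbar z μ / (sqNorm z : ℂ)) * z l) := by
  have hu0 : (sqNorm z : ℂ) ≠ 0 := by exact_mod_cast (sqNorm_pos hz).ne'
  have hdet := isUnit_det_metric ha hz
  rw [fullMetric, christoffel_inl_inl_inl hdet (wirtinger_metric_inl_comm ha hz)]
  set Γ : Fin n → ℂ := fun l => -(radialCoeff n a (sqNorm z) : ℂ) *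
    (zbar z μ * delta l α + zbar z α * delta l μ
      - (n + 1) * (zbar z α * zbar z μ / (sqNorm z : ℂ)) * z l) with hΓ
  -- The claimed symbols are checked after lowering with `g`, where the eigenvector relation
  -- suffices; `g` is then cancelled.
  have key : ∀ ν, wirtinger (Sum.inl μ) (fun w => metric a w α ν) z =
      Matrix.vecMul Γ (metric a z) ν := by
    intro ν
    have h : ∀ l, Γ l * metric a z l ν =
        delta l α * (-(radialCoeff n a (sqNorm z) : ℂ) * zbar z μ * metric a z l ν)
        + delta l μ * (-(radialCoeff n a (sqNorm z) : ℂ) * zbar z α * metric a z l ν)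
        + (radialCoeff n a (sqNorm z) : ℂ) * (n + 1) * (zbar z α * zbar z μ / (sqNorm z : ℂ)) *
          (z l * metric a z l ν) := by
      intro l
      simp only [hΓ]
      ring
    rw [Matrix.vecMul, dotProduct]
    simp only [h, Finset.sum_add_distrib, sum_delta_mul, ← Finset.mul_sum, sum_mul_metric]
    rw [wirtinger_metric ha hz _ _ _ rfl rfl rfl, metric_apply, metric_apply]
    simp only [dsqNorm, dz, dzbar, Sum.elim_inl]
    field_simp
    ring
  have h2 : Matrix.vecMul (Matrix.vecMul Γ (metric a z)) (metric a z)⁻¹ = Γ := by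
    rw [Matrix.vecMul_vecMul, Matrix.mul_nonsing_inv _ hdet, Matrix.vecMul_one]
  change _ = Γ l
  rw [← congrFun h2 l, Matrix.vecMul, dotProduct]
  exact Finset.sum_congr rfl fun ν _ => by rw [key, mul_comm]

theorem eventually_ne_zero (hz : z ≠ 0) : ∀ᶠ w in nhds z, w ≠ 0 := isOpen_ne.mem_nhds hz

theorem wirtinger_christoffel_fullMetric (ha : 0 < a) (hz : z ≠ 0) (β l μ α : Fin n) {Q u : ℂ}
    (hQ : Q = (radialCoeff n a (sqNorm z) : ℂ)) (hu : u = (sqNorm z : ℂ)) :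
    wirtinger (Sum.inr β) (christoffel (fullMetric n a) (Sum.inl l) (Sum.inl μ) (Sum.inl α)) z =
      -(Q * (delta β μ * delta l α + delta β α * delta l μ)
        + (n * Q ^ 2 - (n + 1) * Q / u) * z β * (zbar z μ * delta l α + zbar z α * delta l μ)
        - (n + 1) * Q / u * (delta β α * zbar z μ + delta β μ * zbar z α) * z l
        + (n + 1) * Q / u * ((n + 2) / u - n * Q) * z β * zbar z α * zbar z μ * z l) := by
  have hinv : HasWirtingerAt (fun w => (((sqNorm w)⁻¹ : ℝ) : ℂ))
      (fun A => ((-((sqNorm z) ^ 2)⁻¹ : ℝ) : ℂ) * dsqNorm z A) z :=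
    (hasWirtingerAt_sqNorm z).ofReal_comp (hasDerivAt_inv (sqNorm_pos hz).ne')
  have hzb := fun μ => hasWirtingerAt_zbar μ z
  have h := ((hasWirtingerAt_radialCoeff ha hz).const_mul (-1)).mul
    ((((hzb μ).mul (HasWirtingerAt.const (delta l α) z)).add
      ((hzb α).mul (HasWirtingerAt.const (delta l μ) z))).sub
    ((((hzb α).mul (hzb μ)).mul hinv).const_mul ((n : ℂ) + 1) |>.mul (hasWirtingerAt_coord l z)))
  have h' := h.congr_of_eventuallyEq
    (g := christoffel (fullMetric n a) (Sum.inl l) (Sum.inl μ) (Sum.inl α)) (by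
      filter_upwards [eventually_ne_zero hz] with w hw
      rw [christoffel_fullMetric ha hw, Complex.ofReal_inv]
      ring)
  rw [h'.wirtinger_eq]
  push_cast
  rw [← hQ, ← hu]
  simp only [dsqNorm, dz, dzbar, Sum.elim_inr]
  ring

theorem curvature_fullMetric (ha : 0 < a) (hz : z ≠ 0) (μ ν α β : Fin n) {P Q u x : ℂ}
    (hP : P = (conformalFactor n a (sqNorm z) : ℂ)) (hQ : Q = (radialCoeff n a (sqNorm z) : ℂ))
    (hu : u = (sqNorm z : ℂ)) (hx : x = P * (1 - Q * u))
    {g : Matrix (Fin n) (Fin n) ℂ} (hg : g = metric a z) :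
    curvature (fullMetric n a) (Sum.inl μ) (Sum.inr ν) (Sum.inl α) (Sum.inr β) z =
      Q / P * (g α ν * g μ β + g μ ν * g α β
        - (n + 1) * x * (zbar z μ * z β / u * g α ν + zbar z α * z β / u * g μ ν
          + zbar z μ * z ν / u * g α β + zbar z α * z ν / u * g μ β)
        + (n + 1) * (n + 2) * x ^ 2 * (zbar z μ * z ν * zbar z α * z β / u ^ 2)) := by
  have hu0 : u ≠ 0 := by
    rw [hu]
    exact_mod_cast (sqNorm_pos hz).ne'
  have hP0 : P ≠ 0 := by
    rw [hP]
    exact_mod_cast (conformalFactor_pos ha (sqNorm_pos hz)).ne'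
  rw [fullMetric, curvature_inl_inr_inl_inr
    ((eventually_ne_zero hz).mono fun w hw => isUnit_det_metric ha hw)
    ((eventually_ne_zero hz).mono fun w hw => wirtinger_metric_inl_comm ha hw)
    ((eventually_ne_zero hz).mono fun w hw => wirtinger_metric_inr_comm ha hw), ← fullMetric]
  have hsum : ∀ l, -wirtinger (Sum.inr β)
        (christoffel (fullMetric n a) (Sum.inl l) (Sum.inl α) (Sum.inl μ)) z * metric a z l ν =
      delta l μ * ((Q * delta β α + (n * Q ^ 2 - (n + 1) * Q / u) * z β * zbar z α)
        * metric a z l ν)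
      + delta l α * ((Q * delta β μ + (n * Q ^ 2 - (n + 1) * Q / u) * z β * zbar z μ)
        * metric a z l ν)
      + (-((n + 1) * Q / u * (delta β α * zbar z μ + delta β μ * zbar z α))
        + (n + 1) * Q / u * ((n + 2) / u - n * Q) * z β * zbar z α * zbar z μ) *
        (z l * metric a z l ν) := by
    intro l
    rw [wirtinger_christoffel_fullMetric ha hz _ _ _ _ hQ hu]
    ring
  simp only [hsum, Finset.sum_add_distrib, sum_delta_mul, ← Finset.mul_sum, sum_mul_metric, hg]
  -- Solving the metric for `δ` rewrites the remaining deltas through `g`, as the target requires.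
  have hδ : ∀ μ β, delta β μ = metric a z μ β / P + Q * (zbar z μ * z β) := by
    intro μ β
    rw [metric_apply, ← hP, ← hQ, delta_comm β μ]
    field_simp
    ring
  rw [hδ α β, hδ μ β, ← hP, ← hQ, ← hu, hx]
  field_simp
  ring

end EguchiHanson
end

/-! ### The Kretschmann scalar and the final formulas. -/

namespace EguchiHanson

open ComplexFrame

theorem conj_symSq {n : ℕ} {X : Matrix (Fin n) (Fin n) ℂ} (hX : X.IsHermitian)
    (μ ν α β : Fin n) :
    (starRingEnd ℂ) (symSq X μ ν α β) = symSq X.transpose μ ν α β := by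
  have h : ∀ μ ν, (starRingEnd ℂ) (X μ ν) = X ν μ := fun μ ν => hX.apply ν μ
  simp [symSq, h]

theorem kretschmann_fullMetric {n : ℕ} {a : ℝ} {z : Fin n → ℂ} (ha : 0 < a) (hz : z ≠ 0) :
    kretschmann (fullMetric n a) z =
      (((radialCoeff n a (sqNorm z) / conformalFactor n a (sqNorm z)) ^ 2 *
        ((n : ℝ) * ((n : ℝ) + 2) * ((n : ℝ) ^ 2 - 1)) : ℝ) : ℂ) := by
  have hu0 : (sqNorm z : ℂ) ≠ 0 := by exact_mod_cast (sqNorm_pos hz).ne'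
  have hP0 : (conformalFactor n a (sqNorm z) : ℂ) ≠ 0 := by
    exact_mod_cast (conformalFactor_pos ha (sqNorm_pos hz)).ne'
  have hκ0 := ofReal_one_sub_ne_zero (n := n) ha (sqNorm_pos hz)
  have hdet := isUnit_det_metric ha hz
  have hH := metric_isHermitian a z
  set P : ℂ := (conformalFactor n a (sqNorm z) : ℂ) with hP
  set Q : ℂ := (radialCoeff n a (sqNorm z) : ℂ) with hQ
  set u : ℂ := (sqNorm z : ℂ) with hu
  set g := metric a z with hg
  set x := P * (1 - Q * u) with hx
  -- `k` corrects the quartic term: `2(n+1)² + 2k = (n+1)(n+2)`.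
  set k : ℂ := -((n : ℂ) * (n + 1) / 2) with hk
  set T : Matrix (Fin n) (Fin n) ℂ := (x / u) • Matrix.vecMulVec (zbar z) z with hT
  set B : Matrix (Fin n) (Fin n) ℂ := g - ((n : ℂ) + 1) • T with hB
  have hTa : ∀ μ ν, T μ ν = x / u * (zbar z μ * z ν) := fun μ ν => rfl
  have hTH : T.IsHermitian := by
    ext μ ν
    simp only [Matrix.conjTranspose_apply, hTa, hx, hP, hQ, hu, zbar, RCLike.star_def, map_mul,
      map_div₀, map_sub, map_one, Complex.conj_ofReal, Complex.conj_conj]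
    ring
  have hBH : B.IsHermitian := by
    refine hH.sub ?_
    ext μ ν
    have := hTH.apply μ ν
    simp only [Matrix.conjTranspose_apply, Matrix.smul_apply, star_smul, this]
    simp
  have hcurv : ∀ μ ν α β,
      curvature (fullMetric n a) (Sum.inl μ) (Sum.inr ν) (Sum.inl α) (Sum.inr β) z =
        Q / P * (symSq B μ ν α β + k * symSq T μ ν α β) := by
    intro μ ν α β
    rw [curvature_fullMetric ha hz μ ν α β hP hQ hu hx hg]
    simp only [symSq, hB, hk, Matrix.sub_apply, Matrix.smul_apply, hTa, smul_eq_mul]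
    field_simp
    ring
  have hraised : ∀ μ ν α β,
      curvatureRaised (fullMetric n a) (Sum.inl μ) (Sum.inr ν) (Sum.inl α) (Sum.inr β) z =
        Q / P * (symSq (g⁻¹ * B * g⁻¹).transpose μ ν α β
          + k * symSq (g⁻¹ * T * g⁻¹).transpose μ ν α β) := by
    intro μ ν α β
    rw [fullMetric, curvatureRaised_inl_inr_inl_inr hdet (metric_isHermitian a), ← fullMetric,
      ← hg]
    have hc : ∀ σ ρ γ δ, (starRingEnd ℂ) (Q / P * (symSq B σ ρ γ δ + k * symSq T σ ρ γ δ)) =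
        Q / P * (symSq B.transpose σ ρ γ δ + k * symSq T.transpose σ ρ γ δ) := by
      intro σ ρ γ δ
      rw [← conj_symSq hBH, ← conj_symSq hTH]
      simp [hP, hQ, hk, map_ofNat]
    have e : ∀ σ ρ γ δ, g⁻¹ σ μ * g⁻¹ ν ρ * g⁻¹ γ α * g⁻¹ β δ *
        (Q / P * (symSq B.transpose σ ρ γ δ + k * symSq T.transpose σ ρ γ δ)) =
        Q / P * (g⁻¹ σ μ * g⁻¹ ν ρ * g⁻¹ γ α * g⁻¹ β δ * symSq B.transpose σ ρ γ δ)
        + Q / P * k * (g⁻¹ σ μ * g⁻¹ ν ρ * g⁻¹ γ α * g⁻¹ β δ * symSq T.transpose σ ρ γ δ) := by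
      intros
      ring
    simp only [hcurv, hc, e, Finset.sum_add_distrib, ← Finset.mul_sum, sum_mul_symSq,
      Matrix.transpose_mul, ← Matrix.mul_assoc]
    ring
  have hvec : Matrix.vecMul z g⁻¹ = x⁻¹ • z := by
    have h1 : Matrix.vecMul z g = x • z := funext fun ν => sum_mul_metric a z ν
    have hx0 : x ≠ 0 := mul_ne_zero hP0 hκ0
    have h2 := congrArg (fun v => Matrix.vecMul v g⁻¹) h1
    simp only [Matrix.vecMul_vecMul, Matrix.mul_nonsing_inv _ hdet, Matrix.vecMul_one,
      Matrix.smul_vecMul] at h2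
    rw [eq_inv_smul_iff₀ hx0, ← h2]
  -- The eigenvalue `x` in `T` cancels the `x⁻¹` from `g⁻¹`, leaving the Euclidean projection
  -- determined by `z`.
  have hTg : T * g⁻¹ = u⁻¹ • Matrix.vecMulVec (zbar z) z := by
    have hx0 : x ≠ 0 := mul_ne_zero hP0 hκ0
    rw [hT, Matrix.smul_mul, Matrix.vecMulVec_mul, hvec]
    ext μ ν
    simp only [Matrix.smul_apply, Matrix.vecMulVec_apply, Pi.smul_apply, smul_eq_mul]
    field_simp
  have hdot : z ⬝ᵥ zbar z = u := by
    rw [dotProduct_comm]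
    exact sum_zbar_mul z
  have htr : (T * g⁻¹).trace = 1 := by
    rw [hTg, Matrix.trace_smul, Matrix.trace_vecMulVec, dotProduct_comm, hdot, smul_eq_mul,
      inv_mul_cancel₀ hu0]
  have hidem : T * g⁻¹ * (T * g⁻¹) = T * g⁻¹ := by
    rw [hTg, Matrix.smul_mul, Matrix.mul_smul, Matrix.vecMulVec_mul_vecMulVec, hdot]
    ext μ ν
    simp only [Matrix.smul_apply, Matrix.vecMulVec_apply, Pi.smul_apply, smul_eq_mul]
    field_simp
  have e : ∀ μ ν α β, Q / P * (symSq B μ ν α β + k * symSq T μ ν α β) *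
      (Q / P * (symSq (g⁻¹ * B * g⁻¹).transpose μ ν α β
          + k * symSq (g⁻¹ * T * g⁻¹).transpose μ ν α β)) =
      (Q / P) ^ 2 * ((symSq B μ ν α β + k * symSq T μ ν α β) *
      (symSq (g⁻¹ * B * g⁻¹).transpose μ ν α β
          + k * symSq (g⁻¹ * T * g⁻¹).transpose μ ν α β)) := by
    intros
    ring
  unfold kretschmann
  simp only [hcurv, hraised, e, ← Finset.mul_sum]
  rw [sum_symSq_sub_mul_symSq_sub (N := (n : ℂ)) (by simp) hk (Matrix.mul_nonsing_inv _ hdet) hidem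
    htr hB]
  push_cast
  rfl

end EguchiHanson

theorem mainTheorem4 (n : ℕ) (a : ℝ) (ha : 0 < a) (z : Fin n → ℂ) (hz : z ≠ 0)
    (u : ℝ) (hu : u = EguchiHanson.sqNorm z)
    (g : Matrix (Fin n) (Fin n) ℂ) (hg : g = EguchiHanson.metric a z) :
    (∀ l μ α : Fin n,
      ComplexFrame.christoffel (EguchiHanson.fullMetric n a)
          (Sum.inl l) (Sum.inl μ) (Sum.inl α) z =
        -((a ^ n / (u * (a ^ n + u ^ n)) : ℝ) : ℂ) *
          (EguchiHanson.zbar z μ * EguchiHanson.delta l α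
            + EguchiHanson.zbar z α * EguchiHanson.delta l μ
            - ((n : ℂ) + 1) * (EguchiHanson.zbar z α * EguchiHanson.zbar z μ / (u : ℂ)) * z l)) ∧
    (∀ μ ν α β : Fin n,
      ComplexFrame.curvature (EguchiHanson.fullMetric n a)
          (Sum.inl μ) (Sum.inr ν) (Sum.inl α) (Sum.inr β) z =
        ((a ^ n / (a ^ n + u ^ n) ^ (((n : ℝ) + 1) / (n : ℝ)) : ℝ) : ℂ) *
          (g α ν * g μ β + g μ ν * g α β
            - ((n : ℂ) + 1) *
              (((u / (a ^ n + u ^ n) ^ (1 / (n : ℝ))) ^ (n - 1) : ℝ) : ℂ) *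
              (EguchiHanson.zbar z μ * z β / (u : ℂ) * g α ν
                + EguchiHanson.zbar z α * z β / (u : ℂ) * g μ ν
                + EguchiHanson.zbar z μ * z ν / (u : ℂ) * g α β
                + EguchiHanson.zbar z α * z ν / (u : ℂ) * g μ β)
            + ((n : ℂ) + 1) * ((n : ℂ) + 2) *
              (((u / (a ^ n + u ^ n) ^ (1 / (n : ℝ))) ^ (2 * n - 2) : ℝ) : ℂ) *
              (EguchiHanson.zbar z μ * z ν * EguchiHanson.zbar z α * z β / (u : ℂ) ^ 2))) ∧
    ComplexFrame.kretschmann (EguchiHanson.fullMetric n a) z =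
      ((a ^ (2 * n) / (a ^ n + u ^ n) ^ (2 * (((n : ℝ) + 1) / (n : ℝ))) *
        ((n : ℝ) * ((n : ℝ) + 2) * ((n : ℝ) ^ 2 - 1)) : ℝ) : ℂ) ∧
    (n = 2 →
      ComplexFrame.kretschmann (EguchiHanson.fullMetric n a) z =
        ((24 * a ^ 4 / (a ^ 2 + u ^ 2) ^ 3 : ℝ) : ℂ)) := by

  have hu0 : 0 < u := hu ▸ EguchiHanson.sqNorm_pos hz
  -- A nonzero vector exists only when `n ≥ 1`.
  have hn := EguchiHanson.pos_of_ne_zero hz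
  have hK := EguchiHanson.kretschmann_fullMetric ha hz
  rw [← hu, EguchiHanson.radialCoeff_div_conformalFactor hn ha hu0, div_pow, ← pow_mul,
    ← Real.rpow_mul_natCast (by positivity), mul_comm n 2, mul_comm _ ((2 : ℕ) : ℝ)] at hK
  refine ⟨fun l μ α => ?_, fun μ ν α β => ?_, ?_, ?_⟩
  · rw [EguchiHanson.christoffel_fullMetric ha hz, ← hu]
    rfl
  · rw [EguchiHanson.curvature_fullMetric ha hz μ ν α β rfl rfl rfl rfl hg, ← hu,
      ← EguchiHanson.radialCoeff_div_conformalFactor hn ha hu0,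
      show 2 * n - 2 = (n - 1) * 2 by omega, pow_mul,
      ← EguchiHanson.conformalFactor_mul_eq hn ha hu0]
    push_cast
    rfl
  · simpa using hK
  · rintro rfl
    rw [hK]
    -- For `n = 2` the real exponent is the integer `3`, and `24 = 2 · 4 · 3`.
    have h3 : ((2 : ℕ) : ℝ) * ((((2 : ℕ) : ℝ) + 1) / ((2 : ℕ) : ℝ)) = ((3 : ℕ) : ℝ) := by norm_num
    rw [h3, Real.rpow_natCast]
    congr 1
    push_cast
    ring
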